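/- For a finite simple graph $G$ with vertex set $V$, let $P_G=\operatorname{conv}\{\pm(e_u-e_v) : uv\in E(G)\}\subset\mathbb{R}^V$ be its symmetric edge polytope, and let $N(G)$ denote the number of facets of $P_G$. Let $C_m$ be the cycle with $m$ edges, and let $G\vee H$ denote a graph obtained by identifying a vertex of $G$ with a vertex of $H$. For positive integers $x_1,x_2,x_3$, at most one of which equals $1$, let $CB(x_1,x_2,x_3)$ be the graph made of three internally disjoint paths of lengths $x_1,x_2,x_3$ connecting two common endpoints. Finally, for an integer $k\ge 5$ let $M(2k)=N(G)$, where $$G=\begin{cases}(C_{k+1}\vee C_{k-1})\vee e & \text{if } k \text{ is even},\\ (C_k\vee C_k)\vee e & \text{if } k \text{ is odd},\end{cases}$$ and $e$ is the graph consisting of a single edge. Let $n=2k\ge 10$. Then, for every choice of the identified vertices in the wedges defining $M(2k)$: 1. if $k$ is even, then $N(CB(k,k,1))\le M(2k)$; 2. if $k$ is odd, then $N(CB(k+1,k-1,1))\le M(2k)$. -/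

import Mathlib

namespace SymEdge

/-- A facet of a polytope `P`: a nonempty face (the set of points of `P` at which some linear
functional is maximal on `P`) of dimension one less than the dimension of `P`. -/
def IsFacet {E : Type*} [AddCommGroup E] [Module ℝ E] [TopologicalSpace E] (P F : Set E) : Prop :=
  F.Nonempty ∧ IsExposed ℝ P F ∧
    Module.finrank ℝ (vectorSpan ℝ F) + 1 = Module.finrank ℝ (vectorSpan ℝ P)

/-- The symmetric edge polytope of `G`, the convex hull in `ℝ^V` of the vectors `± (e_u - e_v)` for
the edges `uv` of `G`; both signs occur because adjacency is symmetric. -/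
def symmetricEdgePolytope {V : Type*} [DecidableEq V] (G : SimpleGraph V) : Set (V → ℝ) :=
  convexHull ℝ {x | ∃ u v : V, G.Adj u v ∧ x = Pi.single u 1 - Pi.single v 1}

/-- `N(G)`: the number of facets of the symmetric edge polytope of `G`. -/
noncomputable def N {V : Type*} [Fintype V] [DecidableEq V] (G : SimpleGraph V) : ℕ :=
  {F : Set (V → ℝ) | IsFacet (symmetricEdgePolytope G) F}.ncard

/-- The vertices of a wedge: those of the first graph, and those of the second graph other than
the vertex `b`, which is identified with a vertex of the first graph. -/
abbrev WedgeVertex (V : Type*) {W : Type*} (b : W) : Type _ := V ⊕ {w : W // w ≠ b}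

/-- The inclusion of the second graph into the wedge: it sends `b` to `a`. -/
def wedgeInr {V W : Type*} [DecidableEq W] (a : V) (b : W) (w : W) : WedgeVertex V b :=
  if h : w = b then Sum.inl a else Sum.inr ⟨w, h⟩

/-- The wedge `G ∨ H` obtained by identifying the vertex `a` of `G` with the vertex `b` of `H`:
the union of the images of `G` and `H`. -/
def wedge {V W : Type*} [DecidableEq W] (G : SimpleGraph V) (a : V) (H : SimpleGraph W) (b : W) :
    SimpleGraph (WedgeVertex V b) :=
  G.map Sum.inl ⊔ H.map (wedgeInr a b)

/-- The length of the first cycle in the definition of `M n`; here `n = 2k - 1` or `n = 2k`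
with `k = (n + 1) / 2`. -/
def cycLen₁ (n : ℕ) : ℕ := if Even ((n + 1) / 2) then (n + 1) / 2 + 1 else (n + 1) / 2

/-- The length of the second cycle in the definition of `M n`. -/
def cycLen₂ (n : ℕ) : ℕ := if Even ((n + 1) / 2) then (n + 1) / 2 - 1 else (n + 1) / 2

/-- The number `M(n)`, for `n ≥ 3`: the number of facets of the symmetric edge polytope of
`C_{k+1} ∨ C_{k-1}` (`n = 2k-1`, `k` even), `C_k ∨ C_k` (`n = 2k-1`, `k` odd),
`(C_{k+1} ∨ C_{k-1}) ∨ e` (`n = 2k`, `k` even), `(C_k ∨ C_k) ∨ e` (`n = 2k`, `k` odd),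
where `e` is a single edge. The wedges are formed at the vertices `a`, `b` of the two cycles, and
at the vertex `c` of the wedge of the cycles and the endpoint `d` of `e` (`c` and `d` play no role
for odd `n`). -/
noncomputable def M (n : ℕ) (a : Fin (cycLen₁ n)) (b : Fin (cycLen₂ n))
    (c : WedgeVertex (Fin (cycLen₁ n)) b) (d : Fin 2) : ℕ :=
  if Even n then
    N (wedge (wedge (SimpleGraph.cycleGraph (cycLen₁ n)) a
      (SimpleGraph.cycleGraph (cycLen₂ n)) b) c (⊤ : SimpleGraph (Fin 2)) d)
  else
    N (wedge (SimpleGraph.cycleGraph (cycLen₁ n)) a (SimpleGraph.cycleGraph (cycLen₂ n)) b)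

/-- The vertices of `CB m`: the two common endpoints, and `m i - 1` inner vertices on the `i`-th
path. -/
abbrev CBVertex {t : ℕ} (m : Fin t → ℕ) : Type := Fin 2 ⊕ (Σ i : Fin t, Fin (m i - 1))

/-- The `j`-th vertex (`0 ≤ j ≤ m i`) of the `i`-th path of `CB m`. -/
def CBPath {t : ℕ} (m : Fin t → ℕ) (i : Fin t) (j : ℕ) : CBVertex m :=
  if h0 : j = 0 then Sum.inl 0
  else if h : j < m i then Sum.inr ⟨i, ⟨j - 1, by omega⟩⟩
  else Sum.inl 1

/-- `CB m` for a vector `m` of positive integers: internally disjoint paths of lengths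
`m 0, m 1, …` connecting two endpoints. -/
def CB {t : ℕ} (m : Fin t → ℕ) : SimpleGraph (CBVertex m) :=
  SimpleGraph.fromRel fun x y => ∃ i : Fin t, ∃ j : Fin (m i),
    x = CBPath m i j ∧ y = CBPath m i (j + 1)

end SymEdge

/-!
For a connected graph `G` the facets of `P_G` correspond to the integral height functions `f` on
the vertices, normalised at a base vertex, that change by at most one along each edge and for which
the edges with change exactly one (the tight edges) connect all vertices
(`N_eq_ncard_facetHeights`). Indeed, `P_G` is centrally symmetric, so a facet is cut out by an
inequality `g ≤ 1` whose tight generators span the same space as all generators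
(`isFacet_convexHull_iff`); by duality this means that a function constant along the tight edges is
constant (`span_tight_eq_iff`), and applied to the fractional part of `v ↦ g (e_v)` it shows that
`g` may be taken integral.

Height functions on a wedge are pairs of height functions on its parts, so `N` is multiplicative
under wedges (`N_wedge`). On paths and cycles, a height function is recorded by its steps, which lie
in `{-1, 0, 1}`, and tightness allows at most one step `0`; such sequences with given total are
counted by binomial coefficients (`card_stepSeqs_of_card_eq`, `card_stepSeqs_of_card_eq_succ`).
With `B p` for the central binomial coefficient `(2p choose p)`, this gives
* `N(C_{2p+1}) ≥ (2p+1) B p` (`le_N_cycleGraph`), hence a lower bound for `M(2k)`, as both cycles in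
  its definition are odd;
* `N(CB(2p, 2q, 1)) ≤ B p * B q * (2pq + 1)` (`N_CB_even_le`), where the two long paths contribute
  `B p * B q` if the endpoints have equal heights, and `(p * B p) * (q * B q)` for each of the two
  possible height differences `±1` otherwise.

The relation `(s+1) B (s+1) = 2 (2s+1) B s` reduces the comparison to
`2 (s+1)² + 1 ≤ (2s+3)(s+1)` for `k = 2s+2`, and to `2 s (s+1) + 1 ≤ (2s+1)(s+1)` for `k = 2s+1`.
-/

namespace SymEdge

/-! ### Facets of centrally symmetric polytopes -/

section Polytope

variable {E : Type*} [NormedAddCommGroup E] [NormedSpace ℝ E]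

/-- The face of `convexHull ℝ S` cut out by a valid inequality `g ≤ 1` is spanned by the points
of `S` at which the inequality is tight. -/
theorem convexHull_inter_eq_one {S : Set E} {g : E →ₗ[ℝ] ℝ} (hg : ∀ s ∈ S, g s ≤ 1) :
    {x ∈ convexHull ℝ S | g x = 1} = convexHull ℝ {s ∈ S | g s = 1} := by
  set T := {s ∈ S | g s = 1} with hT
  have hT1 : ∀ x ∈ convexHull ℝ T, g x = 1 := by
    have hc : Convex ℝ {x : E | g x = 1} := convex_hyperplane g.isLinear 1
    exact fun x hx => convexHull_min (fun s hs => hs.2) hc hx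
  apply Set.Subset.antisymm
  · -- The points with `g < 1` together with the hull of the tight points form a convex set.
    have hK : Convex ℝ ({x : E | g x < 1} ∪ convexHull ℝ T) := by
      rw [convex_iff_forall_pos]
      have key : ∀ x y : E, g x < 1 → g y ≤ 1 → ∀ a b : ℝ, 0 < a → 0 < b → a + b = 1 →
          g (a • x + b • y) < 1 := by
        intro x y hx hy a b ha hb hab
        simp only [map_add, map_smul, smul_eq_mul]
        nlinarith
      rintro x (hx | hx) y (hy | hy) a b ha hb hab
      · exact Or.inl (key x y hx (le_of_lt hy) a b ha hb hab)
      · exact Or.inl (key x y hx (hT1 y hy).le a b ha hb hab)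
      · rw [add_comm]
        exact Or.inl (key y x hy (hT1 x hx).le b a hb ha (by rwa [add_comm]))
      · exact Or.inr ((convex_convexHull ℝ T) hx hy ha.le hb.le hab)
    have hSK : S ⊆ {x : E | g x < 1} ∪ convexHull ℝ T := by
      intro s hs
      rcases (hg s hs).lt_or_eq with h | h
      · exact Or.inl h
      · exact Or.inr (subset_convexHull ℝ T ⟨hs, h⟩)
    rintro x ⟨hx, hx1⟩
    rcases convexHull_min hSK hK hx with h | h
    · exact absurd hx1 (ne_of_lt h)
    · exact h
  · exact fun x hx => ⟨convexHull_mono (fun s hs => hs.1) hx, hT1 x hx⟩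

theorem vectorSpan_convexHull (S : Set E) :
    vectorSpan ℝ (convexHull ℝ S) = vectorSpan ℝ S := by
  rw [← direction_affineSpan, affineSpan_convexHull, direction_affineSpan]

/-- If `T` lies on an affine hyperplane that misses the origin, then the linear span of `T` has one
dimension more than its affine span. -/
theorem finrank_vectorSpan_add_one [FiniteDimensional ℝ E] {T : Set E} (hT : T.Nonempty)
    {g : E →ₗ[ℝ] ℝ} (hg : ∀ t ∈ T, g t = 1) :
    Module.finrank ℝ (vectorSpan ℝ T) + 1 = Module.finrank ℝ (Submodule.span ℝ T) := by
  obtain ⟨t₀, ht₀⟩ := hT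
  have hne : t₀ ≠ 0 := by
    rintro rfl
    simpa using hg 0 ht₀
  have hker : vectorSpan ℝ T ≤ LinearMap.ker g := by
    rw [vectorSpan_def, Submodule.span_le]
    rintro _ ⟨x, hx, y, hy, rfl⟩
    simp [hg x hx, hg y hy]
  have hsup : vectorSpan ℝ T ⊔ Submodule.span ℝ {t₀} = Submodule.span ℝ T := by
    apply le_antisymm
    · refine sup_le ?_ (Submodule.span_mono (by simpa using ht₀))
      rw [vectorSpan_def, Submodule.span_le]
      rintro _ ⟨x, hx, y, hy, rfl⟩
      exact Submodule.sub_mem _ (Submodule.subset_span hx) (Submodule.subset_span hy)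
    · rw [Submodule.span_le]
      intro t ht
      have h := Submodule.add_mem_sup (vsub_mem_vectorSpan ℝ ht ht₀)
        (Submodule.mem_span_singleton_self (R := ℝ) t₀)
      simpa using h
  have hinf : vectorSpan ℝ T ⊓ Submodule.span ℝ {t₀} = ⊥ := by
    rw [eq_bot_iff]
    rintro x ⟨hx, hx'⟩
    obtain ⟨c, rfl⟩ := Submodule.mem_span_singleton.1 hx'
    have h : g (c • t₀) = 0 := hker hx
    rw [map_smul, hg t₀ ht₀] at h
    have hc : c = 0 := by simpa using h
    simp [hc]
  have h := Submodule.finrank_sup_add_finrank_inf_eq (vectorSpan ℝ T) (Submodule.span ℝ {t₀})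
  rw [hsup, hinf, finrank_bot, finrank_span_singleton hne] at h
  omega

theorem vectorSpan_eq_span_of_neg_mem {S : Set E} (hS : ∀ s ∈ S, -s ∈ S) :
    vectorSpan ℝ S = Submodule.span ℝ S := by
  apply le_antisymm
  · rw [vectorSpan_def, Submodule.span_le]
    rintro _ ⟨x, hx, y, hy, rfl⟩
    exact Submodule.sub_mem _ (Submodule.subset_span hx) (Submodule.subset_span hy)
  · rw [Submodule.span_le]
    intro s hs
    have h := Submodule.smul_mem _ (2⁻¹ : ℝ) (vsub_mem_vectorSpan ℝ hs (hS s hs))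
    have h2 : (2⁻¹ : ℝ) • (s -ᵥ -s) = s := by
      rw [vsub_eq_sub, sub_neg_eq_add, ← two_smul ℝ s, smul_smul]
      norm_num
    rwa [h2] at h

/-- The facets of a centrally symmetric polytope are cut out by the valid inequalities `g ≤ 1`
whose tight generators span the same space as all generators. -/
theorem isFacet_convexHull_iff [FiniteDimensional ℝ E] {S F : Set E} (hS : ∀ s ∈ S, -s ∈ S)
    (hS0 : ∃ s ∈ S, s ≠ 0) :
    IsFacet (convexHull ℝ S) F ↔ ∃ g : E →ₗ[ℝ] ℝ, (∀ s ∈ S, g s ≤ 1) ∧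
      F = {x ∈ convexHull ℝ S | g x = 1} ∧
      Submodule.span ℝ {s ∈ S | g s = 1} = Submodule.span ℝ S := by
  have hdim : Module.finrank ℝ (vectorSpan ℝ (convexHull ℝ S)) =
      Module.finrank ℝ (Submodule.span ℝ S) := by
    rw [vectorSpan_convexHull, vectorSpan_eq_span_of_neg_mem hS]
  constructor
  · rintro ⟨hne, hexp, hfin⟩
    obtain ⟨l, hl⟩ := hexp hne
    obtain ⟨x₀, hx₀⟩ := hne
    have hx₀' := hx₀
    rw [hl] at hx₀'
    obtain ⟨hx₀P, hmax⟩ := hx₀'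
    have hSc : ∀ s ∈ S, l s ≤ l x₀ := fun s hs => hmax s (subset_convexHull ℝ S hs)
    -- A functional with maximum `0` vanishes on the polytope, by symmetry, and cuts out no
    -- proper face.
    have hpos : 0 < l x₀ := by
      by_contra! hc
      have hl0 : ∀ s ∈ S, l s = 0 := by
        intro s hs
        have h1 := hSc s hs
        have h2 := hSc (-s) (hS s hs)
        rw [map_neg] at h2
        linarith
      have hl0' : ∀ x ∈ convexHull ℝ S, l x = 0 := fun x hx =>
        convexHull_min (t := {x : E | l x = 0}) hl0
          (convex_hyperplane l.toLinearMap.isLinear 0) hx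
      have hFP : F = convexHull ℝ S := by
        rw [hl]
        exact Set.Subset.antisymm (fun x hx => hx.1)
          (fun x hx => ⟨hx, fun y hy => by rw [hl0' x hx, hl0' y hy]⟩)
      rw [hFP] at hfin
      omega
    have hle : ∀ s ∈ S, ((l x₀)⁻¹ • l.toLinearMap) s ≤ 1 := by
      intro s hs
      have := hSc s hs
      simp only [LinearMap.smul_apply, ContinuousLinearMap.coe_coe, smul_eq_mul]
      rw [inv_mul_le_iff₀ hpos]
      linarith
    have hF : F = {x ∈ convexHull ℝ S | ((l x₀)⁻¹ • l.toLinearMap) x = 1} := by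
      rw [hl]
      ext x
      simp only [Set.mem_ofPred_eq, LinearMap.smul_apply, ContinuousLinearMap.coe_coe,
        smul_eq_mul]
      refine and_congr_right fun hx => ?_
      rw [inv_mul_eq_one₀ hpos.ne']
      exact ⟨fun h => le_antisymm (h x₀ hx₀P) (hmax x hx), fun h y hy => h ▸ hmax y hy⟩
    refine ⟨(l x₀)⁻¹ • l.toLinearMap, hle, hF, ?_⟩
    rw [convexHull_inter_eq_one hle] at hF
    have hTne : {s ∈ S | ((l x₀)⁻¹ • l.toLinearMap) s = 1}.Nonempty := by
      rw [← convexHull_nonempty_iff (𝕜 := ℝ), ← hF]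
      exact ⟨x₀, hx₀⟩
    have hB := finrank_vectorSpan_add_one hTne (fun t ht => ht.2)
    rw [hF, vectorSpan_convexHull, hdim, hB] at hfin
    exact Submodule.eq_of_le_of_finrank_eq (Submodule.span_mono fun s hs => hs.1) hfin
  · rintro ⟨g, hg, rfl, hspan⟩
    have hTne : {s ∈ S | g s = 1}.Nonempty := by
      rw [Set.nonempty_iff_ne_empty]
      intro h
      rw [h, Submodule.span_empty] at hspan
      obtain ⟨s, hs, hs0⟩ := hS0
      have : s ∈ (⊥ : Submodule ℝ E) := hspan ▸ Submodule.subset_span hs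
      exact hs0 (by simpa using this)
    obtain ⟨t, ht, ht1⟩ := id hTne
    have hle : ∀ x ∈ convexHull ℝ S, g x ≤ 1 := fun x hx =>
      convexHull_min (t := {x : E | g x ≤ 1}) hg (convex_halfSpace_le g.isLinear 1) hx
    refine ⟨⟨t, subset_convexHull ℝ S ht, ht1⟩, fun _ => ⟨LinearMap.toContinuousLinearMap g, ?_⟩,
      ?_⟩
    · ext x
      simp only [Set.mem_ofPred_eq, LinearMap.coe_toContinuousLinearMap']
      refine and_congr_right fun hx => ⟨fun h y hy => h ▸ hle y hy, fun h => ?_⟩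
      exact le_antisymm (hle x hx) (ht1 ▸ h t (subset_convexHull ℝ S ht))
    · rw [hdim, ← hspan, convexHull_inter_eq_one hg, vectorSpan_convexHull]
      exact finrank_vectorSpan_add_one hTne (fun t ht => ht.2)

end Polytope

/-! ### Facets of symmetric edge polytopes as height functions -/

section Height

variable {V : Type*}

/-- Preconnectedness, tested by real functions that are constant along the edges. -/
theorem preconnected_iff_forall_const {G : SimpleGraph V} :
    G.Preconnected ↔
      ∀ w : V → ℝ, (∀ u v, G.Adj u v → w u = w v) → ∀ u v, w u = w v := by
  classical
  constructor
  · intro hG w hw u v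
    obtain ⟨p⟩ := hG u v
    induction p with
    | nil => rfl
    | cons h _ ih => exact (hw _ _ h).trans ih
  · intro h u v
    by_contra huv
    have := h (fun x => if G.Reachable u x then 1 else 0) (fun x y hxy => ?_) u v
    · simp [huv] at this
    · have : G.Reachable u x ↔ G.Reachable u y :=
        ⟨fun h => h.trans hxy.reachable, fun h => h.trans hxy.symm.reachable⟩
      simp [this]

/-- The graph of the edges of `G` along which `f` changes by exactly one. -/
def tightGraph (G : SimpleGraph V) (f : V → ℤ) : SimpleGraph V where
  Adj u v := G.Adj u v ∧ |f u - f v| = 1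
  symm := ⟨fun u v h => ⟨h.1.symm, by rw [abs_sub_comm]; exact h.2⟩⟩
  loopless := ⟨fun u h => h.1.ne rfl⟩

/-- The integral height functions on `G`, normalised to vanish at `v₀`, that define facets: they
change by at most one along each edge, and the edges along which they change connect `V`. -/
def facetHeights (G : SimpleGraph V) (v₀ : V) : Set (V → ℤ) :=
  {f | f v₀ = 0 ∧ (∀ u v, G.Adj u v → f u - f v ≤ 1) ∧ (tightGraph G f).Preconnected}

theorem abs_sub_le_one_of_adj {G : SimpleGraph V} {v₀ : V} {f : V → ℤ}
    (hf : f ∈ facetHeights G v₀) {u v : V} (h : G.Adj u v) : |f u - f v| ≤ 1 := by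
  rw [abs_le]
  have h1 := hf.2.1 u v h
  have h2 := hf.2.1 v u h.symm
  omega

/-- A facet height function is determined by its upward steps of height one. -/
theorem facetHeights_ext {G : SimpleGraph V} {v₀ : V} {f f' : V → ℤ}
    (hf : f ∈ facetHeights G v₀) (hf' : f' ∈ facetHeights G v₀)
    (h : ∀ u v, G.Adj u v → f u - f v = 1 → f' u - f' v = 1) : f = f' := by
  have key := preconnected_iff_forall_const.1 hf.2.2 (fun v => ((f v - f' v : ℤ) : ℝ)) ?_
  · funext v
    have := key v v₀
    rw [Int.cast_inj, hf.1, hf'.1] at this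
    omega
  · rintro u v ⟨hadj, huv⟩
    rw [Int.cast_inj]
    rcases (abs_eq zero_le_one).1 huv with h1 | h1
    · have := h u v hadj h1
      omega
    · have := h v u hadj.symm (by omega)
      omega

theorem finite_facetHeights [Finite V] (G : SimpleGraph V) (v₀ : V) :
    (facetHeights G v₀).Finite := by
  refine Set.Finite.of_finite_image
    (f := fun f : V → ℤ => {p : V × V | G.Adj p.1 p.2 ∧ f p.1 - f p.2 = 1}) (Set.toFinite _) ?_
  intro f hf f' hf' h
  refine facetHeights_ext hf hf' fun u v hadj huv => ?_
  have : (u, v) ∈ {p : V × V | G.Adj p.1 p.2 ∧ f' p.1 - f' p.2 = 1} := by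
    rw [← show _ = {p : V × V | G.Adj p.1 p.2 ∧ f' p.1 - f' p.2 = 1} from h]
    exact ⟨hadj, huv⟩
  exact this.2

variable [Fintype V] [DecidableEq V]

/-- The linear functional on `V → ℝ` with coefficients `w`. -/
noncomputable def pairing (w : V → ℝ) : (V → ℝ) →ₗ[ℝ] ℝ := Fintype.linearCombination ℝ w

theorem pairing_single_sub (w : V → ℝ) (u v : V) :
    pairing w (Pi.single u 1 - Pi.single v 1) = w u - w v := by
  simp [pairing, Fintype.linearCombination_apply_single]

/-- The face of the symmetric edge polytope on which the pairing with `f` is `1`. -/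
def heightFace (G : SimpleGraph V) (f : V → ℤ) : Set (V → ℝ) :=
  {x ∈ symmetricEdgePolytope G | pairing (fun v => (f v : ℝ)) x = 1}

/-- The tight generators span the space of all generators exactly when the tight edges connect the
graph: a separating functional is the same as a function that is constant along tight edges but
not along all edges. -/
theorem span_tight_eq_iff {G H : SimpleGraph V} (hG : G.Preconnected) {T : Set (V → ℝ)}
    (hT : ∀ x ∈ T, ∃ u v, H.Adj u v ∧ x = Pi.single u 1 - Pi.single v 1)
    (hT' : ∀ u v, H.Adj u v →
      (Pi.single u 1 - Pi.single v 1 : V → ℝ) ∈ T ∨ (Pi.single v 1 - Pi.single u 1 : V → ℝ) ∈ T)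
    (hHG : H ≤ G) :
    Submodule.span ℝ T =
      Submodule.span ℝ {x : V → ℝ | ∃ u v, G.Adj u v ∧ x = Pi.single u 1 - Pi.single v 1} ↔
      H.Preconnected := by
  constructor
  · intro h
    rw [preconnected_iff_forall_const] at hG ⊢
    intro w hw
    refine hG w fun u v huv => ?_
    have hker : Submodule.span ℝ T ≤ LinearMap.ker (pairing w) := by
      rw [Submodule.span_le]
      intro x hx
      obtain ⟨u, v, huv, rfl⟩ := hT x hx
      change pairing w _ = 0
      rw [pairing_single_sub, hw u v huv, sub_self]
    have hmem : (Pi.single u 1 - Pi.single v 1 : V → ℝ) ∈ Submodule.span ℝ T :=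
      h ▸ Submodule.subset_span ⟨u, v, huv, rfl⟩
    have h0 : pairing w (Pi.single u 1 - Pi.single v 1) = 0 := hker hmem
    rw [pairing_single_sub] at h0
    linarith
  · intro h
    apply le_antisymm
    · refine Submodule.span_mono fun x hx => ?_
      obtain ⟨u, v, huv, rfl⟩ := hT x hx
      exact ⟨u, v, hHG huv, rfl⟩
    · rw [Submodule.span_le]
      rintro _ ⟨u, v, -, rfl⟩
      by_contra hx
      obtain ⟨φ, hφ, hle⟩ := Submodule.exists_le_ker_of_notMem hx
      have key := preconnected_iff_forall_const.1 h (fun a => φ (Pi.single a 1)) ?_ u v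
      · apply hφ
        rw [map_sub, key, sub_self]
      · intro a b hab
        rcases hT' a b hab with hm | hm
        · have h0 : φ _ = 0 := hle (Submodule.subset_span hm)
          rw [map_sub] at h0
          linarith
        · have h0 : φ _ = 0 := hle (Submodule.subset_span hm)
          rw [map_sub] at h0
          linarith

/-- The facets of the symmetric edge polytope of a connected graph are the faces given by the
facet height functions. -/
theorem isFacet_symmetricEdgePolytope_iff [Nontrivial V] {G : SimpleGraph V}
    (hG : G.Preconnected) (v₀ : V) (F : Set (V → ℝ)) :
    IsFacet (symmetricEdgePolytope G) F ↔ ∃ f ∈ facetHeights G v₀, heightFace G f = F := by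
  set S := {x : V → ℝ | ∃ u v, G.Adj u v ∧ x = Pi.single u 1 - Pi.single v 1} with hSdef
  have hP : symmetricEdgePolytope G = convexHull ℝ S := rfl
  have hS : ∀ s ∈ S, -s ∈ S := by
    rintro _ ⟨u, v, h, rfl⟩
    exact ⟨v, u, h.symm, by rw [neg_sub]⟩
  have hS0 : ∃ s ∈ S, s ≠ 0 := by
    obtain ⟨u, h⟩ := hG.exists_adj_of_nontrivial v₀
    refine ⟨_, ⟨v₀, u, h, rfl⟩, fun h0 => ?_⟩
    have := congrFun h0 v₀
    simp [h.ne] at this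
  have htight : ∀ (f : V → ℤ) (g : (V → ℝ) →ₗ[ℝ] ℝ),
      (∀ u v, g (Pi.single u 1 - Pi.single v 1) = f u - f v) →
      (Submodule.span ℝ {s ∈ S | g s = 1} = Submodule.span ℝ S ↔
        (tightGraph G f).Preconnected) := by
    intro f g hg
    refine span_tight_eq_iff hG ?_ ?_ (fun u v h => h.1)
    · rintro _ ⟨⟨u, v, h, rfl⟩, h1⟩
      refine ⟨u, v, ⟨h, ?_⟩, rfl⟩
      rw [hg] at h1
      have : f u - f v = 1 := by exact_mod_cast h1
      rw [this, abs_one]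
    · rintro u v ⟨h, h1⟩
      rcases (abs_eq zero_le_one).1 h1 with h1 | h1
      · exact Or.inl ⟨⟨u, v, h, rfl⟩, by rw [hg]; exact_mod_cast h1⟩
      · refine Or.inr ⟨⟨v, u, h.symm, rfl⟩, ?_⟩
        rw [hg]
        have : f v - f u = 1 := by omega
        exact_mod_cast this
  rw [hP, isFacet_convexHull_iff hS hS0]
  constructor
  · rintro ⟨g, hg, rfl, hspan⟩
    set h : V → ℝ := fun v => g (Pi.single v 1) with hh
    have hgs : ∀ u v, g (Pi.single u 1 - Pi.single v 1) = h u - h v := fun u v => map_sub _ _ _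
    -- Tight edges change `h` by `±1`, so all values of `h` agree modulo `1`.
    let H : SimpleGraph V :=
      { Adj := fun u v => G.Adj u v ∧ |h u - h v| = 1
        symm := ⟨fun u v hu => ⟨hu.1.symm, by rw [abs_sub_comm]; exact hu.2⟩⟩
        loopless := ⟨fun u hu => hu.1.ne rfl⟩ }
    have hH : H.Preconnected := by
      refine (span_tight_eq_iff hG ?_ ?_ (fun u v (h : H.Adj u v) => h.1)).1 hspan
      · rintro _ ⟨⟨u, v, huv, rfl⟩, h1⟩
        rw [hgs] at h1
        exact ⟨u, v, ⟨huv, by rw [h1, abs_one]⟩, rfl⟩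
      · rintro u v ⟨huv, h1⟩
        rcases (abs_eq zero_le_one).1 h1 with h1 | h1
        · exact Or.inl ⟨⟨u, v, huv, rfl⟩, by rw [hgs, h1]⟩
        · exact Or.inr ⟨⟨v, u, huv.symm, rfl⟩, by rw [hgs]; linarith⟩
    have hfract : ∀ v, Int.fract (h v) = Int.fract (h v₀) := by
      refine fun v => preconnected_iff_forall_const.1 hH (fun v => Int.fract (h v)) ?_ v v₀
      rintro u v ⟨-, h1⟩
      rw [Int.fract_eq_fract]
      rcases (abs_eq zero_le_one).1 h1 with h1 | h1
      · exact ⟨1, by rw [h1]; norm_num⟩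
      · exact ⟨-1, by rw [h1]; norm_num⟩
    choose f hf using fun v => Int.fract_eq_fract.1 (hfract v)
    have hgf : ∀ u v, g (Pi.single u 1 - Pi.single v 1) = f u - f v := fun u v => by
      rw [hgs, ← hf u, ← hf v]
      ring
    have hf1 : ∀ u v, G.Adj u v → f u - f v ≤ 1 := by
      intro u v huv
      have := hg _ ⟨u, v, huv, rfl⟩
      rw [hgf] at this
      exact_mod_cast this
    refine ⟨f, ⟨?_, hf1, (htight f g hgf).1 hspan⟩, ?_⟩
    · have := hf v₀
      rw [sub_self] at this
      exact_mod_cast this.symm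
    · ext x
      refine and_congr_right fun hx => ?_
      -- `g` and the pairing with `f` agree on the span of the generators.
      have : pairing (fun v => (f v : ℝ)) x = g x := by
        refine convexHull_min (t := {x : V → ℝ | pairing (fun v => (f v : ℝ)) x = g x}) ?_ ?_ hx
        · rintro _ ⟨u, v, -, rfl⟩
          change pairing _ _ = g _
          rw [pairing_single_sub, hgf]
        · exact (LinearMap.eqLocus (pairing fun v => (f v : ℝ)) g).convex
      rw [this]
  · rintro ⟨f, hf, rfl⟩
    have hgf : ∀ u v, pairing (fun v => (f v : ℝ)) (Pi.single u 1 - Pi.single v 1) =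
        f u - f v := fun u v => pairing_single_sub _ u v
    refine ⟨pairing fun v => (f v : ℝ), ?_, rfl, (htight f _ hgf).2 hf.2.2⟩
    rintro _ ⟨u, v, huv, rfl⟩
    rw [hgf]
    exact_mod_cast hf.2.1 u v huv

/-- The number of facets of the symmetric edge polytope is the number of facet height functions. -/
theorem N_eq_ncard_facetHeights [Nontrivial V] {G : SimpleGraph V} (hG : G.Preconnected)
    (v₀ : V) : N G = (facetHeights G v₀).ncard := by
  have himage : {F : Set (V → ℝ) | IsFacet (symmetricEdgePolytope G) F} =
      heightFace G '' facetHeights G v₀ :=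
    Set.ext fun F => isFacet_symmetricEdgePolytope_iff hG v₀ F
  rw [N, himage, Set.InjOn.ncard_image]
  intro f hf f' hf' h
  refine facetHeights_ext hf hf' fun u v huv h1 => ?_
  have hmem : (Pi.single u 1 - Pi.single v 1 : V → ℝ) ∈ heightFace G f :=
    ⟨subset_convexHull ℝ _ ⟨u, v, huv, rfl⟩, by rw [pairing_single_sub]; exact_mod_cast h1⟩
  rw [h] at hmem
  have h2 := hmem.2
  rw [pairing_single_sub] at h2
  exact_mod_cast h2

end Height

/-- Facet height functions, with connectedness of the tight graph tested by functions. -/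
theorem mem_facetHeights {V : Type*} {G : SimpleGraph V} {v₀ : V} {f : V → ℤ} :
    f ∈ facetHeights G v₀ ↔ f v₀ = 0 ∧ (∀ u v, G.Adj u v → f u - f v ≤ 1) ∧
      ∀ w : V → ℝ, (∀ u v, G.Adj u v → |f u - f v| = 1 → w u = w v) → ∀ u v, w u = w v := by
  simp only [facetHeights, preconnected_iff_forall_const, tightGraph, and_imp]
  rfl

/-! ### Wedges -/

section Wedge

variable {V W : Type*} [DecidableEq W]

theorem wedgeInr_self (a : V) (b : W) : wedgeInr a b b = Sum.inl a := by
  simp [wedgeInr]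

theorem wedgeInr_of_ne (a : V) {b w : W} (h : w ≠ b) : wedgeInr a b w = Sum.inr ⟨w, h⟩ := by
  simp [wedgeInr, h]

theorem wedgeInr_injective (a : V) (b : W) : Function.Injective (wedgeInr a b) := by
  intro x y h
  by_cases hx : x = b <;> by_cases hy : y = b <;> simp_all [wedgeInr]

/-- A property of all edges of a wedge is a property of all edges of the two parts. -/
theorem forall_adj_wedge {G : SimpleGraph V} {a : V} {H : SimpleGraph W} {b : W}
    {p : WedgeVertex V b → WedgeVertex V b → Prop} :
    (∀ x y, (wedge G a H b).Adj x y → p x y) ↔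
      (∀ u v, G.Adj u v → p (Sum.inl u) (Sum.inl v)) ∧
      (∀ u v, H.Adj u v → p (wedgeInr a b u) (wedgeInr a b v)) := by
  constructor
  · intro h
    exact ⟨fun u v huv => h _ _ (Or.inl (SimpleGraph.map_adj_apply' huv
        (Sum.inl_injective.ne huv.ne))),
      fun u v huv => h _ _ (Or.inr (SimpleGraph.map_adj_apply' huv
        ((wedgeInr_injective a b).ne huv.ne)))⟩
  · rintro ⟨h1, h2⟩ x y (⟨-, u, v, huv, rfl, rfl⟩ | ⟨-, u, v, huv, rfl, rfl⟩)
    · exact h1 u v huv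
    · exact h2 u v huv

/-- A function on a wedge is constant as soon as it is constant on both parts, and each function
on a part extends to the wedge by a constant. -/
theorem forall_wedge_const_iff {a : V} {b : W} {P : (V → ℝ) → Prop} {Q : (W → ℝ) → Prop}
    (hP : ∀ c : ℝ, P fun _ => c) (hQ : ∀ c : ℝ, Q fun _ => c) :
    (∀ w : WedgeVertex V b → ℝ, P (w ∘ Sum.inl) ∧ Q (w ∘ wedgeInr a b) → ∀ x y, w x = w y) ↔
      (∀ w : V → ℝ, P w → ∀ u v, w u = w v) ∧ (∀ w : W → ℝ, Q w → ∀ u v, w u = w v) := by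
  constructor
  · intro h
    constructor
    · intro w hw u v
      refine h (Sum.elim w fun _ => w a) ⟨hw, ?_⟩ (Sum.inl u) (Sum.inl v)
      convert hQ (w a) using 1
      funext x
      by_cases hx : x = b
      · subst hx
        simp [wedgeInr_self]
      · simp [wedgeInr_of_ne a hx]
    · intro w hw u v
      have hw' : Sum.elim (fun _ : V => w b) (fun x : {x : W // x ≠ b} => w x) ∘ wedgeInr a b =
          w := by
        funext x
        by_cases hx : x = b
        · subst hx
          simp [wedgeInr_self]
        · simp [wedgeInr_of_ne a hx]
      have key := h (Sum.elim (fun _ => w b) fun x => w x) ⟨hP _, hw'.symm ▸ hw⟩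
        (wedgeInr a b u) (wedgeInr a b v)
      have hu := congrFun hw' u
      have hv := congrFun hw' v
      simp only [Function.comp_apply] at hu hv
      rw [← hu, ← hv, key]
  · rintro ⟨h1, h2⟩ w ⟨hw1, hw2⟩
    have key : ∀ x, w x = w (Sum.inl a) := by
      rintro (u | ⟨u, hu⟩)
      · exact h1 _ hw1 u a
      · have := h2 _ hw2 u b
        simpa [wedgeInr_self, wedgeInr_of_ne a hu] using this
    exact fun x y => (key x).trans (key y).symm

theorem mem_facetHeights_wedge {G : SimpleGraph V} {a : V} {H : SimpleGraph W} {b : W}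
    {f : WedgeVertex V b → ℤ} :
    f ∈ facetHeights (wedge G a H b) (Sum.inl a) ↔
      f ∘ Sum.inl ∈ facetHeights G a ∧ f ∘ wedgeInr a b ∈ facetHeights H b := by
  have hc := forall_wedge_const_iff (a := a) (b := b)
    (P := fun w => ∀ u v, G.Adj u v → |f (Sum.inl u) - f (Sum.inl v)| = 1 → w u = w v)
    (Q := fun w => ∀ u v, H.Adj u v →
      |f (wedgeInr a b u) - f (wedgeInr a b v)| = 1 → w u = w v)
    (fun _ _ _ _ _ => rfl) (fun _ _ _ _ _ => rfl)
  simp only [mem_facetHeights, forall_adj_wedge, Function.comp_apply, wedgeInr_self] at hc ⊢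
  rw [hc]
  tauto

theorem preconnected_wedge {G : SimpleGraph V} {H : SimpleGraph W} (hG : G.Preconnected)
    (hH : H.Preconnected) (a : V) (b : W) : (wedge G a H b).Preconnected := by
  rw [preconnected_iff_forall_const] at *
  simp only [forall_adj_wedge]
  exact (forall_wedge_const_iff (P := fun w => ∀ u v, G.Adj u v → w u = w v)
    (Q := fun w => ∀ u v, H.Adj u v → w u = w v) (fun _ _ _ _ => rfl) (fun _ _ _ _ => rfl)).2
    ⟨hG, hH⟩

/-- The number of facets is multiplicative under wedges. -/
theorem N_wedge [Fintype V] [DecidableEq V] [Fintype W] [Nontrivial V] [Nontrivial W]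
    {G : SimpleGraph V} {H : SimpleGraph W} (hG : G.Preconnected) (hH : H.Preconnected)
    (a : V) (b : W) : N (wedge G a H b) = N G * N H := by
  have : Nontrivial (WedgeVertex V b) := Sum.inl_injective.nontrivial
  rw [N_eq_ncard_facetHeights (preconnected_wedge hG hH a b) (Sum.inl a),
    N_eq_ncard_facetHeights hG a, N_eq_ncard_facetHeights hH b, ← Set.ncard_prod]
  refine Set.BijOn.ncard_eq (f := fun f => (f ∘ Sum.inl, f ∘ wedgeInr a b)) ⟨?_, ?_, ?_⟩
  · exact fun f hf => mem_facetHeights_wedge.1 hf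
  · intro f hf f' hf' h
    obtain ⟨h1, h2⟩ := Prod.mk.inj h
    funext x
    rcases x with u | ⟨u, hu⟩
    · exact congrFun h1 u
    · simpa [wedgeInr_of_ne a hu] using congrFun h2 u
  · rintro ⟨g, h⟩ ⟨hg, hh⟩
    have h2 : Sum.elim g (fun x : {x : W // x ≠ b} => h x) ∘ wedgeInr a b = h := by
      funext x
      by_cases hx : x = b
      · subst hx
        simpa [wedgeInr_self] using hg.1.trans hh.1.symm
      · simp [wedgeInr_of_ne a hx]
    have h1 : Sum.elim g (fun x : {x : W // x ≠ b} => h x) ∘ Sum.inl = g := rfl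
    exact ⟨Sum.elim g fun x => h x, mem_facetHeights_wedge.2 ⟨h1.symm ▸ hg, h2.symm ▸ hh⟩,
      Prod.ext h1 h2⟩

end Wedge

/-- The symmetric edge polytope of a single edge is a segment, with two facets. -/
theorem N_top_fin_two : N (⊤ : SimpleGraph (Fin 2)) = 2 := by
  rw [N_eq_ncard_facetHeights SimpleGraph.preconnected_top 0]
  have h : facetHeights (⊤ : SimpleGraph (Fin 2)) 0 = {![0, 1], ![0, -1]} := by
    ext f
    have hf : f = ![f 0, f 1] := by
      funext i
      fin_cases i <;> rfl
    simp only [mem_facetHeights, Fin.forall_fin_two, Set.mem_insert_iff, Set.mem_singleton_iff,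
      SimpleGraph.top_adj]
    constructor
    · rintro ⟨h0, ⟨⟨-, h1⟩, h2, -⟩, h3⟩
      have h1 := h1 (by decide)
      have h2 := h2 (by decide)
      -- A height function that is constant on the edge leaves the graph disconnected.
      have hne : f 1 ≠ 0 := by
        intro h10
        have := (h3 ![0, 1] (by simp [h0, h10])).1.2
        simp at this
      have : f 1 = 1 ∨ f 1 = -1 := by omega
      rw [hf, h0]
      rcases this with h | h <;> simp [h]
    · rintro (rfl | rfl) <;> simp
  rw [h, Set.ncard_pair]
  simp

/-! ### Counting step sequences -/

section Steps

variable {ι : Type*} [Fintype ι] [DecidableEq ι]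

/-- The sequences of steps `-1`, `0`, `1` with vanishing set `Z` and total `δ`. -/
def signSeqs (Z : Finset ι) (δ : ℤ) : Finset (ι → ℤ) :=
  {d ∈ Fintype.piFinset fun _ => {-1, 0, 1} | (∀ i, d i = 0 ↔ i ∈ Z) ∧ ∑ i, d i = δ}

/-- The sequences of steps `-1`, `0`, `1` with at most one step `0` and total `δ`. -/
def stepSeqs (ι : Type*) [Fintype ι] [DecidableEq ι] (δ : ℤ) : Finset (ι → ℤ) :=
  {d ∈ Fintype.piFinset fun _ => {-1, 0, 1} |
    (∀ i j, d i = 0 → d j = 0 → i = j) ∧ ∑ i, d i = δ}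

theorem mem_signSeqs {Z : Finset ι} {δ : ℤ} {d : ι → ℤ} :
    d ∈ signSeqs Z δ ↔ (∀ i, d i = -1 ∨ d i = 0 ∨ d i = 1) ∧ (∀ i, d i = 0 ↔ i ∈ Z) ∧
      ∑ i, d i = δ := by
  simp [signSeqs]

theorem mem_stepSeqs {δ : ℤ} {d : ι → ℤ} :
    d ∈ stepSeqs ι δ ↔ (∀ i, d i = -1 ∨ d i = 0 ∨ d i = 1) ∧
      (∀ i j, d i = 0 → d j = 0 → i = j) ∧ ∑ i, d i = δ := by
  simp [stepSeqs]

theorem sum_eq_two_mul_card_sub {d : ι → ℤ} (hd : ∀ i, d i = -1 ∨ d i = 0 ∨ d i = 1)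
    {Z : Finset ι} (hZ : ∀ i, d i = 0 ↔ i ∈ Z) :
    ∑ i, d i = 2 * (Finset.univ.filter fun i => d i = 1).card - (Zᶜ.card : ℤ) := by
  have h : ∀ i, d i = 2 * (if d i = 1 then 1 else 0) - (if i ∈ Zᶜ then 1 else 0) := by
    intro i
    simp only [Finset.mem_compl, ← hZ i]
    rcases hd i with h | h | h <;> rw [h] <;> simp
  rw [Finset.sum_congr rfl fun i _ => h i, Finset.sum_sub_distrib, ← Finset.mul_sum,
    Finset.sum_boole, Finset.sum_boole, Finset.filter_mem_eq_inter, Finset.univ_inter]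

theorem card_signSeqs {Z : Finset ι} {p q : ℕ} (hZ : Zᶜ.card = p + q) :
    (signSeqs Z ((p : ℤ) - q)).card = (p + q).choose p := by
  rw [← hZ, ← Finset.card_powersetCard]
  refine Finset.card_nbij' (fun d => Finset.univ.filter fun i => d i = 1)
    (fun A i => if i ∈ A then 1 else if i ∈ Z then 0 else -1) ?_ ?_ ?_ ?_
  · intro d hd
    obtain ⟨h1, h2, h3⟩ := mem_signSeqs.1 hd
    rw [sum_eq_two_mul_card_sub h1 h2, hZ] at h3
    refine Finset.mem_coe.2 (Finset.mem_powersetCard.2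
      ⟨fun i hi => ?_, by dsimp only; push_cast at h3; omega⟩)
    rw [Finset.mem_filter] at hi
    rw [Finset.mem_compl, ← h2, hi.2]
    simp
  · intro A hA
    replace hA := Finset.mem_powersetCard.1 (Finset.mem_coe.1 hA)
    have hAZ : ∀ i ∈ A, i ∉ Z := fun i hi => Finset.mem_compl.1 (hA.1 hi)
    have h1 : ∀ i, (if i ∈ A then (1 : ℤ) else if i ∈ Z then 0 else -1) = -1 ∨
        (if i ∈ A then (1 : ℤ) else if i ∈ Z then 0 else -1) = 0 ∨
        (if i ∈ A then (1 : ℤ) else if i ∈ Z then 0 else -1) = 1 := by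
      intro i
      split_ifs <;> simp
    have h2 : ∀ i, (if i ∈ A then (1 : ℤ) else if i ∈ Z then 0 else -1) = 0 ↔ i ∈ Z := by
      intro i
      have := hAZ i
      split_ifs <;> simp_all
    have h3 : (Finset.univ.filter fun i =>
        (if i ∈ A then (1 : ℤ) else if i ∈ Z then 0 else -1) = 1) = A := by
      ext i
      simp only [Finset.mem_filter, Finset.mem_univ, true_and]
      split_ifs <;> simp_all
    refine mem_signSeqs.2 ⟨h1, h2, ?_⟩
    rw [sum_eq_two_mul_card_sub h1 h2, h3, hA.2, hZ]
    push_cast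
    ring
  · intro d hd
    obtain ⟨h1, h2, -⟩ := mem_signSeqs.1 hd
    funext i
    simp only [Finset.mem_filter, Finset.mem_univ, true_and, ← h2 i]
    rcases h1 i with h | h | h <;> rw [h] <;> simp
  · intro A hA
    replace hA := Finset.mem_powersetCard.1 (Finset.mem_coe.1 hA)
    have hAZ : ∀ i ∈ A, i ∉ Z := fun i hi => Finset.mem_compl.1 (hA.1 hi)
    ext i
    simp only [Finset.mem_filter, Finset.mem_univ, true_and]
    split_ifs <;> simp_all

/-- If the total has the parity of the length, no step is `0`. -/
theorem card_stepSeqs_of_card_eq {p q : ℕ} (h : Fintype.card ι = p + q) :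
    (stepSeqs ι ((p : ℤ) - q)).card = (p + q).choose p := by
  rw [← card_signSeqs (Z := (∅ : Finset ι)) (by simpa using h)]
  congr 1
  ext d
  rw [mem_stepSeqs, mem_signSeqs]
  refine and_congr_right fun h1 => ?_
  constructor
  · rintro ⟨h2, h3⟩
    refine ⟨fun j => ⟨fun hj => ?_, by simp⟩, h3⟩
    have hs := sum_eq_two_mul_card_sub h1 (Z := {j})
      (fun i => by simpa using ⟨fun hi => h2 i j hi hj, fun hi => hi ▸ hj⟩)
    have := Finset.card_compl_add_card ({j} : Finset ι)
    rw [Finset.card_singleton] at this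
    omega
  · rintro ⟨h2, h3⟩
    exact ⟨fun i j hi => by simpa using (h2 i).1 hi, h3⟩

/-- If the total does not have the parity of the length, exactly one step is `0`. -/
theorem card_stepSeqs_of_card_eq_succ {p q : ℕ} (h : Fintype.card ι = p + q + 1) :
    (stepSeqs ι ((p : ℤ) - q)).card = (p + q + 1) * (p + q).choose p := by
  have hU : stepSeqs ι ((p : ℤ) - q) =
      Finset.univ.biUnion fun j : ι => signSeqs {j} ((p : ℤ) - q) := by
    ext d
    simp only [Finset.mem_biUnion, Finset.mem_univ, true_and, mem_stepSeqs, mem_signSeqs,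
      Finset.mem_singleton]
    constructor
    · rintro ⟨h1, h2, h3⟩
      by_cases hz : ∃ j, d j = 0
      · obtain ⟨j, hj⟩ := hz
        exact ⟨j, h1, fun i => ⟨fun hi => h2 i j hi hj, fun hi => hi ▸ hj⟩, h3⟩
      · have hs := sum_eq_two_mul_card_sub h1 (Z := ∅)
          (fun i => by simpa using fun hi => hz ⟨i, hi⟩)
        rw [Finset.compl_empty, Finset.card_univ] at hs
        omega
    · rintro ⟨j, h1, h2, h3⟩
      exact ⟨h1, fun i i' hi hi' => ((h2 i).1 hi).trans ((h2 i').1 hi').symm, h3⟩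
  rw [hU, Finset.card_biUnion]
  · have : ∀ j : ι, (signSeqs {j} ((p : ℤ) - q)).card = (p + q).choose p := by
      intro j
      apply card_signSeqs
      have := Finset.card_compl_add_card ({j} : Finset ι)
      rw [Finset.card_singleton] at this
      omega
    simp [this, h]
  · intro i _ j _ hij
    refine Finset.disjoint_left.2 fun d hd hd' => hij ?_
    simpa using ((mem_signSeqs.1 hd').2.1 i).1 (((mem_signSeqs.1 hd).2.1 i).2 (by simp))

end Steps

/-! ### Odd cycles -/

/-- The height function on a cycle whose successive differences are `d`. -/
def cycleHeight {n : ℕ} (d : Fin (n + 1) → ℤ) (u : Fin (n + 1)) : ℤ := ∑ j ∈ Finset.Iio u, d j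

theorem cycleHeight_add_one_sub {n : ℕ} {d : Fin (n + 1) → ℤ} (hd : ∑ i, d i = 0)
    (u : Fin (n + 1)) : cycleHeight d (u + 1) - cycleHeight d u = d u := by
  have hIic : ∑ j ∈ Finset.Iic u, d j = d u + cycleHeight d u := by
    rw [cycleHeight, ← Finset.Iio_insert, Finset.sum_insert (by simp)]
  have key : cycleHeight d (u + 1) = ∑ j ∈ Finset.Iic u, d j := by
    rcases Fin.eq_castSucc_or_eq_last u with ⟨v, rfl⟩ | rfl
    · rw [Fin.coeSucc_eq_succ, cycleHeight]
      rfl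
    · rw [Fin.last_add_one]
      have h0 : cycleHeight d 0 = 0 := by
        rw [cycleHeight]
        apply Finset.sum_eq_zero
        intro j hj
        simp at hj
      have h1 : Finset.Iic (Fin.last n) = Finset.univ := by
        ext j
        simp [Fin.le_last]
      rw [h0, h1, hd]
  rw [key, hIic]
  ring

/-- A step sequence around a cycle, closing up and with at most one step `0`, gives a facet. -/
theorem cycleHeight_mem_facetHeights {n : ℕ} {d : Fin (n + 2) → ℤ}
    (hd : d ∈ stepSeqs (Fin (n + 2)) 0) :
    cycleHeight d ∈ facetHeights (SimpleGraph.cycleGraph (n + 2)) 0 := by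
  obtain ⟨h1, h2, h3⟩ := mem_stepSeqs.1 hd
  have hstep := cycleHeight_add_one_sub h3
  have hadj : ∀ u : Fin (n + 2), (SimpleGraph.cycleGraph (n + 2)).Adj u (u + 1) := fun u => by
    rw [SimpleGraph.cycleGraph_adj]
    exact Or.inr (by simp)
  refine mem_facetHeights.2 ⟨?_, ?_, ?_⟩
  · rw [cycleHeight]
    apply Finset.sum_eq_zero
    intro j hj
    simp at hj
  · intro u v huv
    rw [SimpleGraph.cycleGraph_adj] at huv
    rcases huv with h | h
    · obtain rfl : u = v + 1 := by rw [← h]; abel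
      have := hstep v
      rcases h1 v with h | h | h <;> omega
    · obtain rfl : v = u + 1 := by rw [← h]; abel
      have := hstep u
      rcases h1 u with h | h | h <;> omega
  · intro w hw
    have hne : ∀ u, d u ≠ 0 → w (u + 1) = w u := by
      intro u hu
      refine (hw u (u + 1) (hadj u) ?_).symm
      rw [abs_sub_comm, hstep]
      rcases h1 u with h | h | h
      · rw [h]; rfl
      · exact absurd h hu
      · rw [h]; rfl
    -- The changes of `w` around the cycle add up to zero, so a single one cannot be nonzero.
    have hall : ∀ u, w (u + 1) = w u := by
      intro u
      by_cases hu : d u = 0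
      · have hsum : ∑ v, (w (v + 1) - w v) = 0 := by
          rw [Finset.sum_sub_distrib, sub_eq_zero]
          exact Fintype.sum_equiv (Equiv.addRight 1) _ _ fun _ => rfl
        rw [Finset.sum_eq_single u] at hsum
        · linarith
        · intro v _ hv
          rw [hne v fun h => hv (h2 v u h hu), sub_self]
        · simp
      · exact hne u hu
    have h0 : ∀ u, w u = w 0 := by
      intro u
      induction u using Fin.induction with
      | zero => rfl
      | succ i ih => rw [← Fin.coeSucc_eq_succ, hall, ih]
    exact fun u v => (h0 u).trans (h0 v).symm

theorem le_N_cycleGraph {m : ℕ} (hm : 1 ≤ m) :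
    (2 * m + 1) * (2 * m).choose m ≤ N (SimpleGraph.cycleGraph (2 * m + 1)) := by
  obtain ⟨n, hn⟩ : ∃ n, 2 * m + 1 = n + 2 := ⟨2 * m - 1, by omega⟩
  have hcard := card_stepSeqs_of_card_eq_succ (ι := Fin (n + 2)) (p := m) (q := m)
    (by rw [Fintype.card_fin]; omega)
  rw [sub_self, ← two_mul] at hcard
  rw [← hcard, hn, N_eq_ncard_facetHeights SimpleGraph.cycleGraph_preconnected 0,
    ← Set.ncard_coe_finset]
  refine Set.ncard_le_ncard_of_injOn cycleHeight
    (fun d hd => cycleHeight_mem_facetHeights hd) ?_ (finite_facetHeights _ _)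
  intro d hd d' hd' h
  funext u
  rw [← cycleHeight_add_one_sub (mem_stepSeqs.1 hd).2.2 u,
    ← cycleHeight_add_one_sub (mem_stepSeqs.1 hd').2.2 u, h]

/-! ### Path bundles -/

section CB

variable {t : ℕ} {m : Fin t → ℕ}

theorem CBPath_zero (i : Fin t) : CBPath m i 0 = Sum.inl 0 := by
  simp [CBPath]

theorem CBPath_length {i : Fin t} (h : 0 < m i) : CBPath m i (m i) = Sum.inl 1 := by
  simp [CBPath, h.ne']

theorem CBPath_succ {i : Fin t} (j : Fin (m i - 1)) :
    CBPath m i (j + 1) = Sum.inr ⟨i, j⟩ := by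
  have : (j : ℕ) + 1 < m i := by omega
  simp [CBPath, this]

theorem CB_adj_or_eq {i : Fin t} {j : ℕ} (hj : j < m i) :
    CBPath m i j = CBPath m i (j + 1) ∨ (CB m).Adj (CBPath m i j) (CBPath m i (j + 1)) := by
  by_cases h : CBPath m i j = CBPath m i (j + 1)
  · exact Or.inl h
  · exact Or.inr ⟨h, Or.inl ⟨i, ⟨j, hj⟩, rfl, rfl⟩⟩

theorem preconnected_CB (i₀ : Fin t) (hm : ∀ i, 0 < m i) : (CB m).Preconnected := by
  rw [preconnected_iff_forall_const]
  intro w hw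
  have hpath : ∀ i j, j ≤ m i → w (CBPath m i j) = w (Sum.inl 0) := by
    intro i j
    induction j with
    | zero => rw [CBPath_zero]; exact fun _ => rfl
    | succ j ih =>
      intro hj
      rw [← ih (by omega)]
      rcases CB_adj_or_eq (m := m) (i := i) (j := j) (by omega) with h | h
      · rw [← h]
      · exact (hw _ _ h).symm
  have h0 : ∀ x, w x = w (Sum.inl 0) := by
    rintro (x | ⟨i, j⟩)
    · fin_cases x
      · rfl
      · exact CBPath_length (hm i₀) ▸ hpath i₀ (m i₀) le_rfl
    · rw [← CBPath_succ]
      exact hpath i _ (by omega)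
  exact fun x y => (h0 x).trans (h0 y).symm

/-- The steps of `f` along the `i`-th path. -/
def pathSteps (m : Fin t → ℕ) (i : Fin t) (f : CBVertex m → ℤ) (j : Fin (m i)) : ℤ :=
  f (CBPath m i (j + 1)) - f (CBPath m i j)

/-- A facet height function has at most one step `0` on each path: otherwise the tight edges
would not connect the vertices between two such steps to the endpoints. -/
theorem pathSteps_ne_zero_of_lt {f : CBVertex m → ℤ}
    (hf : f ∈ facetHeights (CB m) (Sum.inl 0)) {i : Fin t} {p q : Fin (m i)} (hpq : p < q)
    (hp : pathSteps m i f p = 0) : pathSteps m i f q ≠ 0 := by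
  intro hq
  -- The indicator function of the vertices between the two steps.
  let w : CBVertex m → ℝ := Sum.elim (fun _ => 0)
    fun x => if x.1 = i ∧ (p : ℕ) ≤ x.2 ∧ (x.2 : ℕ) < q then 1 else 0
  have hw : ∀ i' j, j ≤ m i' →
      w (CBPath m i' j) = if i' = i ∧ (p : ℕ) < j ∧ j ≤ q then 1 else 0 := by
    intro i' j hj
    rcases Nat.eq_zero_or_pos j with rfl | h0
    · rw [CBPath_zero]
      simp [w]
    · rcases hj.lt_or_eq with h1 | rfl
      · obtain ⟨j, rfl⟩ : ∃ l, j = l + 1 := ⟨j - 1, by omega⟩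
        rw [CBPath_succ (⟨j, by omega⟩ : Fin (m i' - 1))]
        simp only [w, Sum.elim_inr]
        congr 1
        simp only [eq_iff_iff]
        refine and_congr_right fun _ => ?_
        omega
      · rw [CBPath_length h0, if_neg]
        · rfl
        · rintro ⟨rfl, -, h⟩
          have := q.2
          omega
  have hstep : ∀ i' (j : Fin (m i')), pathSteps m i' f j ≠ 0 →
      w (CBPath m i' j) = w (CBPath m i' (j + 1)) := by
    intro i' j hj
    rw [hw i' j j.2.le, hw i' (j + 1) j.2]
    by_cases hi : i' = i
    · subst hi
      have h1 : (j : ℕ) ≠ p := fun h => hj (by rw [Fin.ext h, hp])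
      have h2 : (j : ℕ) ≠ q := fun h => hj (by rw [Fin.ext h, hq])
      congr 1
      simp only [eq_iff_iff]
      refine and_congr_right fun _ => ?_
      omega
    · simp [hi]
  have hconst := (mem_facetHeights.1 hf).2.2 w ?_ (CBPath m i (p + 1)) (CBPath m i 0)
  · have hpq' : (p : ℕ) < q := hpq
    rw [hw i (p + 1) p.2, hw i 0 (Nat.zero_le _), if_pos ⟨rfl, by omega, by omega⟩,
      if_neg (by omega)] at hconst
    exact one_ne_zero hconst
  · rintro x y ⟨-, ⟨i', j, rfl, rfl⟩ | ⟨i', j, rfl, rfl⟩⟩ h1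
    · refine hstep i' j fun h => ?_
      rw [abs_sub_comm, ← pathSteps, h] at h1
      exact zero_ne_one h1
    · refine (hstep i' j fun h => ?_).symm
      rw [← pathSteps, h] at h1
      exact zero_ne_one h1

theorem pathSteps_mem_stepSeqs {f : CBVertex m → ℤ}
    (hf : f ∈ facetHeights (CB m) (Sum.inl 0)) {i : Fin t} (hi : 0 < m i) :
    pathSteps m i f ∈ stepSeqs (Fin (m i)) (f (Sum.inl 1)) := by
  refine mem_stepSeqs.2 ⟨fun j => ?_, fun p q hp hq => ?_, ?_⟩
  · have : |pathSteps m i f j| ≤ 1 := by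
      rcases CB_adj_or_eq j.2 with h | h
      · rw [pathSteps, ← h, sub_self, abs_zero]
        exact zero_le_one
      · exact abs_sub_le_one_of_adj hf h.symm
    rw [abs_le] at this
    omega
  · rcases lt_trichotomy p q with h | h | h
    · exact absurd hq (pathSteps_ne_zero_of_lt hf h hp)
    · exact h
    · exact absurd hp (pathSteps_ne_zero_of_lt hf h hq)
  · simp only [pathSteps]
    rw [Fin.sum_univ_eq_sum_range (fun j => f (CBPath m i (j + 1)) - f (CBPath m i j)),
      Finset.sum_range_sub (fun j => f (CBPath m i j)), CBPath_length hi, CBPath_zero, hf.1,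
      sub_zero]

theorem eq_on_path_of_pathSteps_eq {f f' : CBVertex m → ℤ}
    (h0 : f (Sum.inl 0) = f' (Sum.inl 0)) {i : Fin t}
    (h : pathSteps m i f = pathSteps m i f') :
    ∀ j ≤ m i, f (CBPath m i j) = f' (CBPath m i j) := by
  intro j
  induction j with
  | zero => rw [CBPath_zero]; exact fun _ => h0
  | succ j ih =>
    intro hj
    have h1 := ih (by omega)
    have h2 : f (CBPath m i (j + 1)) - f (CBPath m i j) =
      f' (CBPath m i (j + 1)) - f' (CBPath m i j) := congrFun h ⟨j, hj⟩
    omega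

end CB

/-- A facet of `CB(x₁, x₂, 1)` is determined by its steps along the two long paths, which are
step sequences with a common total `δ`; the third path forces `δ ∈ {-1, 0, 1}`. -/
theorem N_CB_le {m : Fin 3 → ℕ} (hm : ∀ i, 0 < m i) (hm2 : m 2 = 1) :
    N (CB m) ≤ ∑ δ ∈ ({-1, 0, 1} : Finset ℤ),
      (stepSeqs (Fin (m 0)) δ).card * (stepSeqs (Fin (m 1)) δ).card := by
  have : Nontrivial (CBVertex m) := Sum.inl_injective.nontrivial
  rw [N_eq_ncard_facetHeights (preconnected_CB 0 hm) (Sum.inl 0)]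
  simp only [← Finset.card_product]
  refine le_trans ?_ Finset.card_biUnion_le
  rw [← Set.ncard_coe_finset]
  refine Set.ncard_le_ncard_of_injOn (fun f => (pathSteps m 0 f, pathSteps m 1 f)) ?_ ?_
    (Finset.finite_toSet _)
  · intro f hf
    refine Finset.mem_coe.2 (Finset.mem_biUnion.2 ⟨f (Sum.inl 1), ?_, Finset.mem_product.2
      ⟨pathSteps_mem_stepSeqs hf (hm 0), pathSteps_mem_stepSeqs hf (hm 1)⟩⟩)
    obtain ⟨h1, -, h3⟩ := mem_stepSeqs.1 (pathSteps_mem_stepSeqs hf (hm 2))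
    have : Unique (Fin (m 2)) := hm2 ▸ inferInstanceAs (Unique (Fin 1))
    rw [Fintype.sum_unique] at h3
    rw [← h3]
    simpa using h1 default
  · intro f hf f' hf' h
    obtain ⟨hs0, hs1⟩ := Prod.mk.inj h
    have h0 : f (Sum.inl 0) = f' (Sum.inl 0) := hf.1.trans hf'.1.symm
    have hp0 := eq_on_path_of_pathSteps_eq h0 hs0
    have hp1 := eq_on_path_of_pathSteps_eq h0 hs1
    funext x
    rcases x with x | ⟨i, j⟩
    · fin_cases x
      · exact h0
      · exact CBPath_length (hm 0) ▸ hp0 (m 0) le_rfl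
    · rw [← CBPath_succ]
      fin_cases i
      · exact hp0 _ (by have := j.2; simp only [Fin.zero_eta] at this ⊢; omega)
      · exact hp1 _ (by have := j.2; simp only [Fin.mk_one] at this ⊢; omega)
      · have := j.2
        simp only [Fin.reduceFinMk, hm2] at this
        omega

theorem card_stepSeqs_zero (p : ℕ) : (stepSeqs (Fin (2 * p)) 0).card = p.centralBinom := by
  have h := card_stepSeqs_of_card_eq (ι := Fin (2 * p)) (p := p) (q := p)
    (by rw [Fintype.card_fin, two_mul])
  rwa [sub_self, ← two_mul, ← Nat.centralBinom_eq_two_mul_choose] at h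

/-- The single step `0` can be placed in `2p` ways, and the remaining signs can be chosen in
`(2p - 1 choose p)` ways, which is half of the central binomial coefficient. -/
theorem card_stepSeqs_one {p : ℕ} (hp : 0 < p) {δ : ℤ} (hδ : δ = 1 ∨ δ = -1) :
    (stepSeqs (Fin (2 * p)) δ).card = p * p.centralBinom := by
  obtain ⟨s, rfl⟩ : ∃ s, p = s + 1 := ⟨p - 1, by omega⟩
  have hsymm : (2 * s + 1).choose (s + 1) = (2 * s + 1).choose s := by
    rw [← Nat.choose_symm_half]
  have hcb : (s + 1).centralBinom = 2 * (2 * s + 1).choose s := by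
    rw [Nat.centralBinom_eq_two_mul_choose, show 2 * (s + 1) = 2 * s + 1 + 1 by ring,
      Nat.choose_succ_succ, hsymm]
    ring
  rcases hδ with rfl | rfl
  · have h := card_stepSeqs_of_card_eq_succ (ι := Fin (2 * (s + 1))) (p := s + 1) (q := s)
      (by rw [Fintype.card_fin]; ring)
    rw [show ((s + 1 : ℕ) : ℤ) - s = 1 by push_cast; ring, show s + 1 + s = 2 * s + 1 by ring,
      hsymm] at h
    rw [h, hcb]
    ring
  · have h := card_stepSeqs_of_card_eq_succ (ι := Fin (2 * (s + 1))) (p := s) (q := s + 1)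
      (by rw [Fintype.card_fin]; ring)
    rw [show (s : ℤ) - (s + 1 : ℕ) = -1 by push_cast; ring,
      show s + (s + 1) = 2 * s + 1 by ring] at h
    rw [h, hcb]
    ring

theorem N_CB_even_le {m : Fin 3 → ℕ} {p q : ℕ} (hp : 0 < p) (hq : 0 < q) (h0 : m 0 = 2 * p)
    (h1 : m 1 = 2 * q) (h2 : m 2 = 1) :
    N (CB m) ≤ p.centralBinom * q.centralBinom * (2 * p * q + 1) := by
  refine (N_CB_le ?_ h2).trans ?_
  · intro i
    fin_cases i <;> simp only [Fin.zero_eta, Fin.mk_one, Fin.reduceFinMk] <;> omega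
  · rw [h0, h1, Finset.sum_insert (by decide), Finset.sum_insert (by decide),
      Finset.sum_singleton]
    simp only [card_stepSeqs_zero, card_stepSeqs_one hp (Or.inl rfl),
      card_stepSeqs_one hq (Or.inl rfl), card_stepSeqs_one hp (Or.inr rfl),
      card_stepSeqs_one hq (Or.inr rfl)]
    exact le_of_eq (by ring)

/-! ### The comparison -/

theorem M_two_mul_ge {k p q : ℕ} (hp : 1 ≤ p) (hq : 1 ≤ q) (h₁ : cycLen₁ (2 * k) = 2 * p + 1)
    (h₂ : cycLen₂ (2 * k) = 2 * q + 1) (a : Fin (cycLen₁ (2 * k))) (b : Fin (cycLen₂ (2 * k)))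
    (c : WedgeVertex (Fin (cycLen₁ (2 * k))) b) (d : Fin 2) :
    2 * ((2 * p + 1) * p.centralBinom * ((2 * q + 1) * q.centralBinom)) ≤ M (2 * k) a b c d := by
  have : Nontrivial (Fin (cycLen₁ (2 * k))) := Fin.nontrivial_iff_two_le.2 (by omega)
  have : Nontrivial (Fin (cycLen₂ (2 * k))) := Fin.nontrivial_iff_two_le.2 (by omega)
  have : Nontrivial (WedgeVertex (Fin (cycLen₁ (2 * k))) b) := Sum.inl_injective.nontrivial
  have hc₁ := SimpleGraph.cycleGraph_preconnected (n := cycLen₁ (2 * k))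
  have hc₂ := SimpleGraph.cycleGraph_preconnected (n := cycLen₂ (2 * k))
  rw [M, if_pos (even_two_mul k), N_wedge (preconnected_wedge hc₁ hc₂ a b)
    SimpleGraph.preconnected_top, N_wedge hc₁ hc₂, N_top_fin_two, h₁, h₂, mul_comm 2]
  exact Nat.mul_le_mul_right 2 (Nat.mul_le_mul (le_N_cycleGraph hp) (le_N_cycleGraph hq))

end SymEdge

theorem mainTheorem6 (k : ℕ) (hk : 10 ≤ 2 * k)
    (a : Fin (SymEdge.cycLen₁ (2 * k))) (b : Fin (SymEdge.cycLen₂ (2 * k)))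
    (c : SymEdge.WedgeVertex (Fin (SymEdge.cycLen₁ (2 * k))) b) (d : Fin 2) :
    (Even k → SymEdge.N (SymEdge.CB ![k, k, 1]) ≤ SymEdge.M (2 * k) a b c d) ∧
    (Odd k → SymEdge.N (SymEdge.CB ![k + 1, k - 1, 1]) ≤ SymEdge.M (2 * k) a b c d) := by
  have hhalf : (2 * k + 1) / 2 = k := by omega
  constructor
  · intro hev
    obtain ⟨r, hr⟩ := id hev
    obtain ⟨s, rfl⟩ : ∃ s, r = s + 1 := ⟨r - 1, by omega⟩
    have h₁ : SymEdge.cycLen₁ (2 * k) = 2 * (s + 1) + 1 := by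
      rw [SymEdge.cycLen₁, hhalf, if_pos hev]
      omega
    have h₂ : SymEdge.cycLen₂ (2 * k) = 2 * s + 1 := by
      rw [SymEdge.cycLen₂, hhalf, if_pos hev]
      omega
    refine (SymEdge.N_CB_even_le (m := ![k, k, 1]) (p := s + 1) (q := s + 1) (by omega)
      (by omega) (by simp; omega) (by simp; omega) rfl).trans
      (le_trans ?_ (SymEdge.M_two_mul_ge (by omega) (by omega) h₁ h₂ a b c d))
    have hcb := Nat.succ_mul_centralBinom_succ s
    calc (s + 1).centralBinom * (s + 1).centralBinom * (2 * (s + 1) * (s + 1) + 1)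
        ≤ (s + 1).centralBinom * (s + 1).centralBinom * ((2 * (s + 1) + 1) * (s + 1)) :=
          Nat.mul_le_mul_left _ (by nlinarith)
      _ = (2 * (s + 1) + 1) * (s + 1).centralBinom * ((s + 1) * (s + 1).centralBinom) := by ring
      _ = _ := by rw [hcb]; ring
  · intro hodd
    obtain ⟨s, hs⟩ := id hodd
    have hev : ¬ Even k := Nat.not_even_iff_odd.2 hodd
    have h₁ : SymEdge.cycLen₁ (2 * k) = 2 * s + 1 := by
      rw [SymEdge.cycLen₁, hhalf, if_neg hev, hs]
    have h₂ : SymEdge.cycLen₂ (2 * k) = 2 * s + 1 := by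
      rw [SymEdge.cycLen₂, hhalf, if_neg hev, hs]
    refine (SymEdge.N_CB_even_le (m := ![k + 1, k - 1, 1]) (p := s + 1) (q := s) (by omega)
      (by omega) (by simp; omega) (by simp; omega) rfl).trans
      (le_trans ?_ (SymEdge.M_two_mul_ge (by omega) (by omega) h₁ h₂ a b c d))
    have hcb := Nat.succ_mul_centralBinom_succ s
    -- The relation between consecutive central binomials is free of division after
    -- multiplication by `s + 1`.
    refine Nat.le_of_mul_le_mul_left ?_ (show 0 < s + 1 by omega)
    calc (s + 1) * ((s + 1).centralBinom * s.centralBinom * (2 * (s + 1) * s + 1))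
        = (s + 1) * (s + 1).centralBinom * s.centralBinom * (2 * (s + 1) * s + 1) := by ring
      _ = 2 * (2 * s + 1) * s.centralBinom * s.centralBinom * (2 * (s + 1) * s + 1) := by rw [hcb]
      _ ≤ 2 * (2 * s + 1) * s.centralBinom * s.centralBinom * ((2 * s + 1) * (s + 1)) :=
          Nat.mul_le_mul_left _ (by nlinarith)
      _ = _ := by ring
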